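/- **Theorem 1.5 (generalized Beraha–Kahane–Weiss theorem).** Let $D \subset \mathbb{C}$ be a domain (a nonempty connected open set), let $m \ge 2$, and let $\alpha_1,\dots,\alpha_m,\beta_1,\dots,\beta_m$ be analytic functions on $D$, none of which is identically zero. Call an index $k$ *dominant at* $z \in D$ if $|\beta_k(z)| \ge |\beta_l(z)|$ for all $1 \le l \le m$, and let $D_k = \{z \in D : k \text{ is dominant at } z\}$. Assume the "no-degenerate-dominance" condition: there do not exist indices $k \ne k'$ such that $\beta_k \equiv \omega\beta_{k'}$ on $D$ for some constant $\omega$ with $|\omega| = 1$ and such that $D_k$ ($= D_{k'}$) has nonempty interior. For each integer $n \ge 0$ define $$f_n(z) = \sum_{k=1}^m \alpha_k(z)\,\beta_k(z)^n, \qquad \mathcal{Z}(f_n) = \{z \in D : f_n(z) = 0\}.$$ Let $\liminf \mathcal{Z}(f_n)$ (respectively $\limsup \mathcal{Z}(f_n)$) be the set of all $z \in D$ such that every neighborhood $U$ of $z$ satisfies $U \cap \mathcal{Z}(f_n) \neq \emptyset$ for all but finitely many $n$ (respectively for infinitely many $n$). Then $\liminf \mathcal{Z}(f_n) = \limsup \mathcal{Z}(f_n)$,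 and a point $z \in D$ lies in this set if and only if either (a) there is a unique dominant index $k$ at $z$, and $\alpha_k(z) = 0$; or (b) there are two or more dominant indices at $z$. -/

import Mathlib

open Filter Topology

namespace BKW

/-- The zero set in `D` of a function `f`. -/
def zeroSet (D : Set ℂ) (f : ℂ → ℂ) : Set ℂ :=
  {z ∈ D | f z = 0}

/-- The points of `D` all of whose neighborhoods meet all but finitely many of the sets `Z n`. -/
def liminfSets (D : Set ℂ) (Z : ℕ → Set ℂ) : Set ℂ :=
  {z ∈ D | ∀ U ∈ 𝓝 z, ∀ᶠ n in atTop, (U ∩ Z n).Nonempty}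

/-- The points of `D` all of whose neighborhoods meet infinitely many of the sets `Z n`
(that is, `Z n` for infinitely many `n`). -/
def limsupSets (D : Set ℂ) (Z : ℕ → Set ℂ) : Set ℂ :=
  {z ∈ D | ∀ U ∈ 𝓝 z, ∃ᶠ n in atTop, (U ∩ Z n).Nonempty}

/-- The index `k` is dominant at `z`: `|β_k(z)| ≥ |β_l(z)|` for all `l`. -/
def IsDominant {m : ℕ} (β : Fin m → ℂ → ℂ) (k : Fin m) (z : ℂ) : Prop :=
  ∀ l : Fin m, ‖β l z‖ ≤ ‖β k z‖

/-- The set `D_k` of points of `D` at which the index `k` is dominant. -/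
def dominanceSet {m : ℕ} (D : Set ℂ) (β : Fin m → ℂ → ℂ) (k : Fin m) : Set ℂ :=
  {z ∈ D | IsDominant β k z}

/-- There are no indices `k ≠ k'` such that `β_k ≡ ω β_{k'}` on `D` for a constant `ω` with
`|ω| = 1` and such that `D_k` has nonempty interior. -/
def NoDegenerateDominance {m : ℕ} (D : Set ℂ) (β : Fin m → ℂ → ℂ) : Prop :=
  ¬ ∃ k k' : Fin m, k ≠ k' ∧
    (∃ ω : ℂ, ‖ω‖ = 1 ∧ ∀ z ∈ D, β k z = ω * β k' z) ∧
    (interior (dominanceSet D β k)).Nonempty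

/-- The function `f_n = ∑ k, α_k β_k ^ n`. -/
noncomputable def fSeq {m : ℕ} (α β : Fin m → ℂ → ℂ) (n : ℕ) (z : ℂ) : ℂ :=
  ∑ k : Fin m, α k z * β k z ^ n

end BKW

/-! Where `k` is strictly dominant, `f_n / β_k ^ n → α_k` locally uniformly, so zeros accumulate
there exactly at zeros of `α_k` (Hurwitz).

Let two indices be dominant at `z₀`, with nonzero values, and suppose `f_n` is zero-free near `z₀`
for infinitely many `n`. Close to `z₀` there is a point `p` where some `k` is strictly dominant and
`α_k ≠ 0`. By the maximum modulus principle and the no-degeneracy condition, `k` cannot dominate on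
a whole neighborhood of `z₀`, so there is also a point `q` where another `k'` is strictly dominant
and `α_k' ≠ 0`. Along these `n`, `g_n = f_n / β_k ^ n` has a logarithm `F_n` on a ball about `p`
containing `q`. By Borel–Carathéodory `F_n / n` is bounded on smaller balls, and it tends to 0 near
`p`, hence at `q`. So `g_n(q)` grows subexponentially, whereas `|g_n(q)| ~ |α_k'(q)| |β_k'(q) /
β_k(q)| ^ n`. -/

/-! ### Growth of zero-free holomorphic functions -/

open Metric in
-- A Vitali-type propagation. Cauchy estimates on a small circle send each Taylor coefficient at 0
-- to 0; those on a circle beyond `q` give a geometric majorant, so dominated convergence applies to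
-- the Taylor series at `q`.
theorem Complex.tendsto_zero_of_bounded_of_tendstoUniformlyOn {ι : Type*} {L : Filter ι}
    {ψ : ι → ℂ → ℂ} {R C r : ℝ} (hr : 0 < r)
    (hd : ∀ᶠ n in L, DifferentiableOn ℂ (ψ n) (ball 0 R))
    (hC : ∀ᶠ n in L, ∀ z ∈ ball (0 : ℂ) R, ‖ψ n z‖ ≤ C)
    (hu : TendstoUniformlyOn ψ 0 L (ball 0 r)) {q : ℂ} (hq : q ∈ ball (0 : ℂ) R) :
    Tendsto (fun n => ψ n q) L (𝓝 0) := by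
  obtain ⟨R', hqR', hR'R⟩ := exists_between (mem_ball_zero_iff.mp hq)
  have hR' : 0 < R' := (norm_nonneg q).trans_lt hqR'
  have hR : 0 < R := hR'.trans hR'R
  obtain ⟨s, hs0, hs⟩ := exists_between (lt_min hr hR)
  have hsr : s < r := hs.trans_le (min_le_left _ _)
  have hsR : s < R := hs.trans_le (min_le_right _ _)
  have key : Tendsto (fun n => ∑' j : ℕ, (j.factorial : ℂ)⁻¹ * iteratedDeriv j (ψ n) 0 * (q - 0) ^ j)
      L (𝓝 (∑' j : ℕ, (0 : ℂ))) := by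
    refine tendsto_tsum_of_dominated_convergence (bound := fun j => |C| * (‖q‖ / R') ^ j) ?_ ?_ ?_
    · refine (summable_geometric_of_lt_one (by positivity) ?_).mul_left _
      rwa [div_lt_one hR']
    · intro j
      rw [Metric.tendsto_nhds]
      intro ε hε
      have hK : 0 < ‖q‖ ^ j / s ^ j + 1 := by positivity
      filter_upwards [hd, Metric.tendstoUniformlyOn_iff.mp hu (ε / (‖q‖ ^ j / s ^ j + 1))
        (by positivity)] with n hdn hn
      have hdc : DiffContOnCl ℂ (ψ n) (ball 0 s) :=
        (hdn.mono (closedBall_subset_ball hsR)).diffContOnCl_ball subset_rfl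
      have h1 := norm_iteratedDeriv_le_of_forall_mem_sphere_norm_le j hs0 hdc
        (C := ε / (‖q‖ ^ j / s ^ j + 1)) (fun z hz => by
          have := hn z (closedBall_subset_ball hsr (sphere_subset_closedBall hz))
          simpa [dist_eq_norm] using this.le)
      have hj : (0 : ℝ) < j.factorial := by positivity
      rw [dist_zero_right, sub_zero, norm_mul, norm_mul, norm_inv, norm_pow, Complex.norm_natCast]
      calc (j.factorial : ℝ)⁻¹ * ‖iteratedDeriv j (ψ n) 0‖ * ‖q‖ ^ j
          ≤ (j.factorial : ℝ)⁻¹ * (j.factorial * (ε / (‖q‖ ^ j / s ^ j + 1)) / s ^ j) * ‖q‖ ^ j := by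
            gcongr
        _ = ε * ((‖q‖ ^ j / s ^ j) / (‖q‖ ^ j / s ^ j + 1)) := by field_simp
        _ < ε * 1 := by
            gcongr
            rw [div_lt_one hK]
            linarith
        _ = ε := mul_one ε
    · filter_upwards [hd, hC] with n hdn hn j
      have hdc : DiffContOnCl ℂ (ψ n) (ball 0 R') :=
        (hdn.mono (closedBall_subset_ball hR'R)).diffContOnCl_ball subset_rfl
      have h1 := norm_iteratedDeriv_le_of_forall_mem_sphere_norm_le j hR' hdc
        (C := |C|) (fun z hz => (hn z (closedBall_subset_ball hR'R
          (sphere_subset_closedBall hz))).trans (le_abs_self C))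
      rw [sub_zero, norm_mul, norm_mul, norm_inv, norm_pow, Complex.norm_natCast]
      calc (j.factorial : ℝ)⁻¹ * ‖iteratedDeriv j (ψ n) 0‖ * ‖q‖ ^ j
          ≤ (j.factorial : ℝ)⁻¹ * (j.factorial * |C| / R' ^ j) * ‖q‖ ^ j := by gcongr
        _ = |C| * (‖q‖ / R') ^ j := by rw [div_pow]; field_simp
  rw [tsum_zero] at key
  refine key.congr' ?_
  filter_upwards [hd] with n hdn
  exact Complex.taylorSeries_eq_on_ball' hq hdn

-- `F` is a primitive of `g' / g`. The principal value at the centre keeps `Im (F c)` within `π`.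
open Metric in
theorem Complex.exists_differentiableOn_ball_exp_eq {g : ℂ → ℂ} {c : ℂ} {R : ℝ} (hR : 0 < R)
    (hg : DifferentiableOn ℂ g (ball c R)) (h0 : ∀ z ∈ ball c R, g z ≠ 0) :
    ∃ F : ℂ → ℂ, DifferentiableOn ℂ F (ball c R) ∧ F c = Complex.log (g c) ∧
      ∀ z ∈ ball c R, Complex.exp (F z) = g z := by
  have hc : c ∈ ball c R := mem_ball_self hR
  have hq : DifferentiableOn ℂ (fun z => deriv g z / g z) (ball c R) :=
    (hg.deriv isOpen_ball).div hg h0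
  obtain ⟨F, hFc, hF⟩ := hq.isExactOn_ball.with_val_at c (Complex.log (g c))
  refine ⟨F, fun z hz => (hF z hz).differentiableAt.differentiableWithinAt, hFc, fun z hz => ?_⟩
  have hder : ∀ z ∈ ball c R, HasDerivAt (fun z => g z * Complex.exp (-F z)) 0 z := by
    intro z hz
    have h1 := (hg.differentiableAt (isOpen_ball.mem_nhds hz)).hasDerivAt
    have := h0 z hz
    refine (h1.mul (hF z hz).neg.cexp).congr_deriv ?_
    field_simp
    ring
  have hconst := (convex_ball c R).is_const_of_fderivWithin_eq_zero (𝕜 := ℂ)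
    (f := fun z => g z * Complex.exp (-F z))
    (fun z hz => (hder z hz).differentiableAt.differentiableWithinAt)
    (fun z hz => by
      rw [fderivWithin_of_isOpen isOpen_ball hz]
      ext
      simp [(hder z hz).deriv]) hz hc
  simp only [hFc, Complex.exp_neg, Complex.exp_log (h0 c hc), mul_inv_cancel₀ (h0 c hc)] at hconst
  rw [← div_eq_mul_inv, div_eq_one_iff_eq (Complex.exp_ne_zero _)] at hconst
  exact hconst.symm

open Metric in
/-- Zero-free holomorphic functions of at most exponential growth in `n` on a ball, which are
bounded near the centre and bounded below at the centre, grow subexponentially on the ball. -/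
theorem Complex.eventually_norm_le_pow_of_ne_zero {L : Filter ℕ} [L.IsCountablyGenerated]
    (hL : L ≤ atTop) {g : ℕ → ℂ → ℂ}
    {R K r C c : ℝ} (hK : 1 < K) (hr : 0 < r) (hc : 0 < c)
    (hd : ∀ᶠ n in L, DifferentiableOn ℂ (g n) (ball 0 R))
    (h0 : ∀ᶠ n in L, ∀ z ∈ ball (0 : ℂ) R, g n z ≠ 0)
    (hgK : ∀ᶠ n in L, ∀ z ∈ ball (0 : ℂ) R, ‖g n z‖ ≤ K ^ n)
    (hgC : ∀ᶠ n in L, ∀ z ∈ ball (0 : ℂ) r, ‖g n z‖ ≤ C)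
    (hgc : ∀ᶠ n in L, c ≤ ‖g n 0‖) {q : ℂ} (hq : q ∈ ball (0 : ℂ) R) {s : ℝ} (hs : 1 < s) :
    ∀ᶠ n in L, ‖g n q‖ ≤ s ^ n := by
  have hex : ∀ n, ∃ F : ℂ → ℂ, DifferentiableOn ℂ (g n) (ball 0 R) →
      (∀ z ∈ ball (0 : ℂ) R, g n z ≠ 0) → DifferentiableOn ℂ F (ball 0 R) ∧
        F 0 = Complex.log (g n 0) ∧ ∀ z ∈ ball (0 : ℂ) R, Complex.exp (F z) = g n z := by
    intro n
    by_cases h : DifferentiableOn ℂ (g n) (ball 0 R) ∧ ∀ z ∈ ball (0 : ℂ) R, g n z ≠ 0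
    · obtain ⟨F, hF⟩ := exists_differentiableOn_ball_exp_eq
        (pos_of_mem_ball hq) h.1 h.2
      exact ⟨F, fun _ _ => hF⟩
    · exact ⟨0, fun h1 h2 => (h ⟨h1, h2⟩).elim⟩
  choose F hF using hex
  have hR : 0 < R := pos_of_mem_ball hq
  have hlogK : 0 < Real.log K := Real.log_pos hK
  have hre : ∀ᶠ n in L, ∀ z ∈ ball (0 : ℂ) R, ∀ a : ℝ, ‖g n z‖ ≤ a →
      (F n z).re ≤ Real.log a := by
    filter_upwards [hd, h0] with n h1 h2 z hz a ha
    have h3 := (hF n h1 h2).2.2 z hz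
    rw [← h3, Complex.norm_exp] at ha
    rwa [Real.le_log_iff_exp_le ((Real.exp_pos _).trans_le ha)]
  have hn1 : ∀ᶠ n in L, 1 ≤ n := hL (eventually_ge_atTop 1)
  -- The logarithms bound the real part at the centre, `π` the argument.
  set B : ℝ := |Real.log c| + |Real.log C| + Real.pi with hB
  have hB0 : 0 ≤ B := by positivity
  have hcenter : ∀ᶠ n in L, ‖F n 0‖ ≤ B := by
    filter_upwards [hd, h0, hgc, hgC] with n h1 h2 h3 h4
    have h5 := h4 0 (mem_ball_self hr)
    have h6 : 0 < ‖g n 0‖ := hc.trans_le h3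
    rw [(hF n h1 h2).2.1]
    refine (Complex.norm_le_abs_re_add_abs_im _).trans ?_
    rw [Complex.log_re, Complex.log_im]
    refine add_le_add ?_ (Complex.abs_arg_le_pi _)
    have h7 := Real.log_le_log hc h3
    have h8 := Real.log_le_log h6 h5
    rw [abs_le]
    constructor
    · linarith [neg_abs_le (Real.log c), abs_nonneg (Real.log C)]
    · linarith [le_abs_self (Real.log C), abs_nonneg (Real.log c)]
  obtain ⟨R', hqR', hR'R⟩ := exists_between (mem_ball_zero_iff.mp hq)
  have hR' : 0 < R' := (norm_nonneg q).trans_lt hqR'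
  have hdF : ∀ᶠ n in L, DifferentiableOn ℂ (fun z => F n z / n) (ball 0 R) := by
    filter_upwards [hd, h0] with n h1 h2
    exact (hF n h1 h2).1.div_const _
  have hbound : ∀ᶠ n in L, ∀ z ∈ ball (0 : ℂ) R', ‖F n z / n‖ ≤
      2 * Real.log K * R' / (R - R') + B * (R + R') / (R - R') := by
    filter_upwards [hdF, hre, hgK, hcenter, hn1] with n h1 h2 h3 h4 h5 z hz
    have hn : (0 : ℝ) < n := by exact_mod_cast h5
    have hz' : ‖z‖ < R' := mem_ball_zero_iff.mp hz
    have hmaps : Set.MapsTo (fun z => F n z / n) (ball 0 R) {z | z.re ≤ Real.log K} := by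
      intro w hw
      have := h2 w hw _ (h3 w hw)
      rw [Real.log_pow] at this
      simp only [Set.mem_ofPred_eq, Complex.div_natCast_re]
      rw [div_le_iff₀ hn]
      linarith
    refine (borelCaratheodory hlogK h1 hmaps hR (ball_subset_ball hR'R.le hz)).trans ?_
    have h6 : ‖F n 0 / n‖ ≤ B := by
      rw [norm_div, Complex.norm_natCast, div_le_iff₀ hn]
      have : (1 : ℝ) ≤ n := by exact_mod_cast h5
      nlinarith
    have h7 : 0 < R - R' := by linarith
    gcongr
  set ρ := min r R with hρ
  have hρ0 : 0 < ρ := lt_min hr hR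
  have hunif : TendstoUniformlyOn (fun (n : ℕ) z => F n z / n) 0 L (ball 0 (ρ / 2)) := by
    -- For `‖z‖ < ρ / 2` the Borel–Carathéodory factors are at most 1 and 3; the `+ 1` keeps the
    -- bound on the real part positive.
    set A := 2 * (|Real.log C| + 1) + 3 * B with hA
    have hlim : Tendsto (fun n : ℕ => A / n) L (𝓝 0) :=
      (tendsto_const_div_atTop_nhds_zero_nat A).mono_left hL
    rw [Metric.tendstoUniformlyOn_iff]
    intro ε hε
    filter_upwards [hdF, hre, hgC, hcenter, hn1, hlim.eventually (gt_mem_nhds hε)] with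
      n h1 h2 h3 h4 h5 h6 z hz
    have hn : (0 : ℝ) < n := by exact_mod_cast h5
    have hz' : ‖z‖ < ρ / 2 := mem_ball_zero_iff.mp hz
    have hmaps : Set.MapsTo (fun z => F n z / n) (ball 0 ρ)
        {z | z.re ≤ (|Real.log C| + 1) / n} := by
      intro w hw
      have := h2 w (ball_subset_ball (min_le_right _ _) hw) _
        (h3 w (ball_subset_ball (min_le_left _ _) hw))
      simp only [Set.mem_ofPred_eq, Complex.div_natCast_re]
      gcongr
      linarith [le_abs_self (Real.log C)]
    have hbc := borelCaratheodory (by positivity)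
      (h1.mono (ball_subset_ball (min_le_right _ _))) hmaps hρ0
      (ball_subset_ball (by linarith) hz)
    have h7 : 0 < ρ - ‖z‖ := by linarith
    have h8 : ‖z‖ / (ρ - ‖z‖) ≤ 1 := by rw [div_le_one h7]; linarith
    have h9 : (ρ + ‖z‖) / (ρ - ‖z‖) ≤ 3 := by rw [div_le_iff₀ h7]; linarith
    rw [Pi.zero_apply, dist_zero_left]
    refine (hbc.trans ?_).trans_lt h6
    rw [norm_div, Complex.norm_natCast, hA, add_div (2 * (|Real.log C| + 1)) (3 * B)]
    have e1 : 2 * ((|Real.log C| + 1) / n) * ‖z‖ / (ρ - ‖z‖) ≤ 2 * (|Real.log C| + 1) / n :=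
      calc _ = 2 * ((|Real.log C| + 1) / n) * (‖z‖ / (ρ - ‖z‖)) := by ring
        _ ≤ 2 * ((|Real.log C| + 1) / n) * 1 := by gcongr
        _ = _ := by ring
    have e2 : ‖F n 0‖ / n * (ρ + ‖z‖) / (ρ - ‖z‖) ≤ 3 * B / n :=
      calc _ = ‖F n 0‖ / n * ((ρ + ‖z‖) / (ρ - ‖z‖)) := by ring
        _ ≤ B / n * 3 := by gcongr
        _ = _ := by ring
    exact add_le_add e1 e2
  have htend := tendsto_zero_of_bounded_of_tendstoUniformlyOn (half_pos hρ0)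
    (hdF.mono fun n h => h.mono (ball_subset_ball hR'R.le)) hbound hunif
    (mem_ball_zero_iff.mpr hqR')
  filter_upwards [hd, h0, hn1, Metric.tendsto_nhds.mp htend _ (Real.log_pos hs)] with n h1 h2 h3 h4
  have hn : (0 : ℝ) < n := by exact_mod_cast h3
  rw [← (hF n h1 h2).2.2 q hq, Complex.norm_exp, ← Real.le_log_iff_exp_le (by positivity),
    Real.log_pow]
  rw [dist_zero_right, norm_div, Complex.norm_natCast, div_lt_iff₀ hn] at h4
  linarith [Complex.re_le_norm (F n q)]

/-! ### Dominant indices and normalized limits -/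

namespace BKW

theorem exists_isDominant {m : ℕ} (hm : 0 < m) (β : Fin m → ℂ → ℂ) (z : ℂ) :
    ∃ k, IsDominant β k z := by
  have : Nonempty (Fin m) := ⟨⟨0, hm⟩⟩
  exact Finite.exists_max fun k => ‖β k z‖

theorem eventually_isDominant_imp {m : ℕ} {β : Fin m → ℂ → ℂ} {z₀ : ℂ}
    (hβ : ∀ k, ContinuousAt (β k) z₀) :
    ∀ᶠ z in 𝓝 z₀, ∀ l, IsDominant β l z → IsDominant β l z₀ := by
  refine eventually_all.mpr fun l => ?_
  by_cases hl : IsDominant β l z₀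
  · exact Eventually.of_forall fun _ _ => hl
  · simp only [IsDominant, not_forall, not_le] at hl
    obtain ⟨j, hj⟩ := hl
    filter_upwards [(hβ l).norm.eventually_lt (hβ j).norm hj] with z hz h
    exact absurd (h j) (not_le.mpr hz)

theorem eventually_nhdsNE_ne_zero {D : Set ℂ} (hDconn : IsPreconnected D) {f : ℂ → ℂ}
    (hf : AnalyticOnNhd ℂ f D) (hf0 : ∃ z ∈ D, f z ≠ 0) {z₀ : ℂ} (hz₀ : z₀ ∈ D) :
    ∀ᶠ z in 𝓝[≠] z₀, f z ≠ 0 := by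
  refine (hf z₀ hz₀).eventually_eq_zero_or_eventually_ne_zero.resolve_left fun h => ?_
  obtain ⟨w, hw, hw0⟩ := hf0
  exact hw0 (hf.eqOn_zero_of_preconnected_of_eventuallyEq_zero hDconn hz₀ h hw)

/-- Under no degenerate dominance, an index which is dominant near `z₀`, and does not vanish
at `z₀`, is the only dominant index at `z₀`. -/
theorem NoDegenerateDominance.eq_of_eventually_isDominant {m : ℕ} {D : Set ℂ}
    {β : Fin m → ℂ → ℂ} (hdom : NoDegenerateDominance D β) (hDopen : IsOpen D)
    (hDconn : IsPreconnected D) (hβ : ∀ k, AnalyticOnNhd ℂ (β k) D) {z₀ : ℂ} (hz₀ : z₀ ∈ D)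
    {k l : Fin m} (hk : ∀ᶠ z in 𝓝 z₀, IsDominant β k z) (hl : IsDominant β l z₀)
    (h0 : β k z₀ ≠ 0) : l = k := by
  by_contra hlk
  have hnorm : ‖β l z₀‖ = ‖β k z₀‖ := le_antisymm (hk.self_of_nhds l) (hl k)
  have hq0 : ‖β l z₀ / β k z₀‖ = 1 := by
    rw [norm_div, hnorm, div_self (norm_ne_zero_iff.mpr h0)]
  have hne : ∀ᶠ z in 𝓝 z₀, β k z ≠ 0 := (hβ k z₀ hz₀).continuousAt.eventually_ne h0
  -- The quotient has modulus at most 1 near `z₀`, with equality at `z₀`.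
  have hconst : ∀ᶠ z in 𝓝 z₀, β l z / β k z = β l z₀ / β k z₀ := by
    refine Complex.eventually_eq_of_isLocalMax_norm (f := fun z => β l z / β k z) ?_ ?_
    · filter_upwards [hne, hDopen.mem_nhds hz₀] with z hz hzD
      exact (hβ l z hzD).differentiableAt.div (hβ k z hzD).differentiableAt hz
    · filter_upwards [hk, hne] with z hz hz0
      simp only [Function.comp_apply]
      rw [hq0, norm_div, div_le_one (norm_pos_iff.mpr hz0)]
      exact hz l
  have heq : Set.EqOn (β l) (fun z => (β l z₀ / β k z₀) * β k z) D := by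
    refine (hβ l).eqOn_of_preconnected_of_eventuallyEq
      (analyticOnNhd_const.mul (hβ k)) hDconn hz₀ ?_
    filter_upwards [hconst, hne] with z hz hz0
    rw [← hz, div_mul_cancel₀ _ hz0]
  refine hdom ⟨l, k, hlk, ⟨β l z₀ / β k z₀, hq0, heq⟩, z₀, ?_⟩
  rw [mem_interior_iff_mem_nhds]
  filter_upwards [hk, hDopen.mem_nhds hz₀] with z hz hzD
  refine ⟨hzD, fun j => ?_⟩
  rw [heq hzD, norm_mul, hq0, one_mul]
  exact hz j

/-- Every nonempty open subset of `D` has a point with a unique dominant index, at which the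
corresponding coefficient does not vanish. -/
theorem NoDegenerateDominance.exists_strictly_dominant {m : ℕ} (hm : 0 < m) {D : Set ℂ}
    {α β : Fin m → ℂ → ℂ} (hdom : NoDegenerateDominance D β) (hDopen : IsOpen D)
    (hDconn : IsPreconnected D) (hα : ∀ k, AnalyticOnNhd ℂ (α k) D)
    (hβ : ∀ k, AnalyticOnNhd ℂ (β k) D)
    (hα0 : ∀ k, ∃ z ∈ D, α k z ≠ 0) (hβ0 : ∀ k, ∃ z ∈ D, β k z ≠ 0)
    {W : Set ℂ} (hW : IsOpen W) (hWne : W.Nonempty) (hWD : W ⊆ D) :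
    ∃ p ∈ W, ∃ k, (∀ l, l ≠ k → ‖β l p‖ < ‖β k p‖) ∧ α k p ≠ 0 := by
  classical
  let dom : ℂ → Finset (Fin m) := fun z => {k | IsDominant β k z}
  have hmem : ∀ k z, k ∈ dom z ↔ IsDominant β k z := fun k z => by simp [dom]
  -- The dominant set can only shrink under small perturbation, so at a point of minimal cardinality
  -- it is locally constant.
  obtain ⟨p, hpW, hmin⟩ : ∃ p ∈ W, ∀ z ∈ W, (dom p).card ≤ (dom z).card := by
    have := WellFounded.has_min (measure fun z => (dom z).card).wf W hWne
    obtain ⟨p, hp, h⟩ := this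
    exact ⟨p, hp, fun z hz => not_lt.mp (h z hz)⟩
  have hpD := hWD hpW
  have hev : ∀ᶠ z in 𝓝 p, z ∈ W ∧ dom z = dom p := by
    filter_upwards [eventually_isDominant_imp fun k => (hβ k p hpD).continuousAt,
      hW.mem_nhds hpW] with z hz hzW
    refine ⟨hzW, Finset.eq_of_subset_of_card_le (fun l hl => ?_) (hmin z hzW)⟩
    exact (hmem l p).mpr (hz l ((hmem l z).mp hl))
  obtain ⟨k, hk⟩ := exists_isDominant hm β p
  obtain ⟨w, ⟨hw, hα', hβ'⟩⟩ := ((hev.eventually_nhds.filter_mono nhdsWithin_le_nhds).and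
    ((eventually_nhdsNE_ne_zero hDconn (hα k) (hα0 k) hpD).and
      (eventually_nhdsNE_ne_zero hDconn (hβ k) (hβ0 k) hpD))).exists
  have hwW := hw.self_of_nhds.1
  have hdomk : ∀ᶠ z in 𝓝 w, IsDominant β k z := by
    filter_upwards [hw] with z hz
    rw [← hmem, hz.2, hmem]
    exact hk
  refine ⟨w, hwW, k, fun l hlk => lt_of_not_ge fun hle => hlk ?_, hα'⟩
  refine hdom.eq_of_eventually_isDominant hDopen hDconn hβ (hWD hwW) hdomk
    (fun j => (hdomk.self_of_nhds j).trans hle) hβ'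

/-- Near a point at which `k` is strictly dominant, `f_n / β_k ^ n` converges uniformly
to `α_k`. -/
theorem exists_nhds_tendstoUniformlyOn {m : ℕ} {α β : Fin m → ℂ → ℂ} {z₀ : ℂ} {k : Fin m}
    (hα : ∀ k, ContinuousAt (α k) z₀) (hβ : ∀ k, ContinuousAt (β k) z₀)
    (h0 : β k z₀ ≠ 0) (hk : ∀ l, l ≠ k → ‖β l z₀‖ < ‖β k z₀‖) :
    ∃ V ∈ 𝓝 z₀, (∀ z ∈ V, β k z ≠ 0) ∧
      TendstoUniformlyOn (fun n z => fSeq α β n z / β k z ^ n) (α k) atTop V := by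
  have hne : ∀ᶠ z in 𝓝 z₀, β k z ≠ 0 := (hβ k).eventually_ne h0
  have hlim : ∀ l, ∃ V ∈ 𝓝 z₀, TendstoUniformlyOn
      (fun n z => if l = k then 0 else α l z * (β l z / β k z) ^ n) 0 atTop V := by
    intro l
    by_cases hl : l = k
    · refine ⟨Set.univ, univ_mem, ?_⟩
      simp only [hl, if_true]
      exact Metric.tendstoUniformlyOn_iff.mpr fun ε hε => Eventually.of_forall fun n z _ => by
        simpa using hε
    · have hlt : ‖β l z₀ / β k z₀‖ < 1 := by
        rw [norm_div, div_lt_one (norm_pos_iff.mpr h0)]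
        exact hk l hl
      obtain ⟨r, hr, hr1⟩ := exists_between hlt
      have hr0 : 0 ≤ r := (norm_nonneg _).trans hr.le
      refine ⟨_, (((hβ l).div (hβ k) h0).norm.eventually_lt continuousAt_const hr).and
        ((hα l).norm.eventually_lt (continuousAt_const (y := ‖α l z₀‖ + 1)) (by simp)), ?_⟩
      rw [Metric.tendstoUniformlyOn_iff]
      intro ε hε
      have ht : Tendsto (fun n : ℕ => (‖α l z₀‖ + 1) * r ^ n) atTop (𝓝 0) := by
        simpa using (tendsto_pow_atTop_nhds_zero_of_lt_one hr0 hr1).const_mul (‖α l z₀‖ + 1)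
      filter_upwards [ht.eventually (gt_mem_nhds hε)] with n hn z hz
      simp only [if_neg hl, Pi.zero_apply, dist_zero_left, norm_mul, norm_pow]
      refine lt_of_le_of_lt ?_ hn
      have h1 := hz.1.le
      have h2 := hz.2.le
      exact mul_le_mul h2 (pow_le_pow_left₀ (norm_nonneg _) h1 n) (by positivity) (by positivity)
  choose V hV hVu using hlim
  refine ⟨{z | β k z ≠ 0} ∩ ⋂ l, V l, inter_mem hne (iInter_mem.mpr hV), fun z hz => hz.1, ?_⟩
  have hsum : TendstoUniformlyOn (fun n z => ∑ l, if l = k then 0 else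
      α l z * (β l z / β k z) ^ n) 0 atTop ({z | β k z ≠ 0} ∩ ⋂ l, V l) := by
    have hfin : ∀ s : Finset (Fin m), TendstoUniformlyOn (fun n z => ∑ l ∈ s, if l = k then 0 else
        α l z * (β l z / β k z) ^ n) 0 atTop ({z | β k z ≠ 0} ∩ ⋂ l, V l) := by
      classical
      intro s
      induction s using Finset.induction_on with
      | empty =>
        exact Metric.tendstoUniformlyOn_iff.mpr fun ε hε => Eventually.of_forall fun n z _ => by
          simpa using hε
      | insert a s ha ih =>
        have := ((hVu a).mono (Set.inter_subset_right.trans (Set.iInter_subset V a))).add ih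
        simp only [Finset.sum_insert ha]
        simpa using! this
    exact hfin _
  rw [Metric.tendstoUniformlyOn_iff] at hsum ⊢
  intro ε hε
  filter_upwards [hsum ε hε] with n hn z hz
  have h := hn z hz
  have hz0 : β k z ≠ 0 := hz.1
  rw [Pi.zero_apply, dist_zero_left] at h
  rw [dist_comm, dist_eq_norm]
  refine lt_of_eq_of_lt (congrArg norm ?_) h
  rw [fSeq, ← Finset.add_sum_erase _ _ (Finset.mem_univ k), add_div,
    mul_div_cancel_right₀ _ (pow_ne_zero n hz0), add_sub_cancel_left, Finset.sum_div,
    ← Finset.add_sum_erase _ (fun l => if l = k then 0 else _) (Finset.mem_univ k), if_pos rfl,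
    zero_add]
  refine Finset.sum_congr rfl fun l hl => ?_
  rw [if_neg (Finset.ne_of_mem_erase hl), div_pow, mul_div_assoc]

end BKW

open Metric in
/-- **Hurwitz's theorem**: an isolated zero of a uniform limit of holomorphic functions attracts
zeros of these functions. -/
theorem Complex.eventually_exists_zero_of_tendstoUniformlyOn {ι : Type*} {L : Filter ι}
    {g : ι → ℂ → ℂ} {f : ℂ → ℂ} {z₀ : ℂ} {ρ : ℝ} (hρ : 0 < ρ)
    (hd : ∀ n, DifferentiableOn ℂ (g n) (closedBall z₀ ρ))
    (hf : ContinuousOn f (sphere z₀ ρ)) (hne : ∀ z ∈ sphere z₀ ρ, f z ≠ 0) (h0 : f z₀ = 0)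
    (hu : TendstoUniformlyOn g f L (closedBall z₀ ρ)) :
    ∀ᶠ n in L, ∃ z ∈ closedBall z₀ ρ, g n z = 0 := by
  obtain ⟨w, hw, hmin⟩ := (isCompact_sphere z₀ ρ).exists_isMinOn
    (NormedSpace.sphere_nonempty.mpr hρ.le) hf.norm
  have hδ : 0 < ‖f w‖ := norm_pos_iff.mpr (hne w hw)
  filter_upwards [Metric.tendstoUniformlyOn_iff.mp hu _ (half_pos hδ)] with n hn
  -- Otherwise the maximum principle for `1 / g n` forces `‖g n z₀‖ ≥ ‖f w‖ / 2`.
  by_contra! hno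
  have hd' : DiffContOnCl ℂ (fun z => (g n z)⁻¹) (ball z₀ ρ) :=
    ((hd n).inv hno).diffContOnCl_ball subset_rfl
  have hb : ∀ z ∈ frontier (ball z₀ ρ), ‖(g n z)⁻¹‖ ≤ (‖f w‖ / 2)⁻¹ := by
    intro z hz
    rw [frontier_ball z₀ hρ.ne'] at hz
    have h1 := hn z (sphere_subset_closedBall hz)
    have h2 : ‖f w‖ ≤ ‖f z‖ := hmin hz
    rw [norm_inv]
    refine inv_anti₀ (half_pos hδ) ?_
    rw [dist_eq_norm] at h1
    linarith [norm_sub_norm_le (f z) (g n z)]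
  have h3 := norm_le_of_forall_mem_frontier_norm_le isBounded_ball hd' hb
    (subset_closure (mem_ball_self hρ))
  have h4 := hn z₀ (mem_closedBall_self hρ.le)
  rw [h0, dist_zero_left] at h4
  rw [norm_inv, inv_le_inv₀ (norm_pos_iff.mpr (hno z₀ (mem_closedBall_self hρ.le)))
    (half_pos hδ)] at h3
  linarith

/-! ### Accumulation of zeros -/

namespace BKW

theorem differentiableOn_fSeq {m : ℕ} {D : Set ℂ} {α β : Fin m → ℂ → ℂ}
    (hα : ∀ k, AnalyticOnNhd ℂ (α k) D) (hβ : ∀ k, AnalyticOnNhd ℂ (β k) D) (n : ℕ) :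
    DifferentiableOn ℂ (fSeq α β n) D := by
  unfold fSeq
  exact DifferentiableOn.fun_sum fun k _ =>
    (hα k).differentiableOn.fun_mul ((hβ k).differentiableOn.fun_pow n)

theorem notMem_limsupSets {m : ℕ} {D : Set ℂ} {α β : Fin m → ℂ → ℂ} {z₀ : ℂ} {k : Fin m}
    (hα : ∀ k, ContinuousAt (α k) z₀) (hβ : ∀ k, ContinuousAt (β k) z₀)
    (h0 : β k z₀ ≠ 0) (hk : ∀ l, l ≠ k → ‖β l z₀‖ < ‖β k z₀‖) (hαk : α k z₀ ≠ 0) :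
    z₀ ∉ limsupSets D (fun n => zeroSet D (fSeq α β n)) := by
  rintro ⟨-, hz⟩
  obtain ⟨V, hV, -, hu⟩ := exists_nhds_tendstoUniformlyOn hα hβ h0 hk
  have hc : 0 < ‖α k z₀‖ := norm_pos_iff.mpr hαk
  have hW : ∀ᶠ z in 𝓝 z₀, ‖α k z₀‖ / 2 < ‖α k z‖ :=
    continuousAt_const.eventually_lt (hα k).norm (half_lt_self hc)
  refine hz _ (inter_mem hV hW) ?_
  filter_upwards [Metric.tendstoUniformlyOn_iff.mp hu _ (half_pos hc)] with n hn
  rintro ⟨z, ⟨hzV, hzW⟩, -, hz0⟩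
  have h1 := hn z hzV
  rw [hz0, zero_div, dist_zero_right] at h1
  exact lt_asymm h1 hzW

theorem mem_liminfSets_of_strictly_dominant {m : ℕ} {D : Set ℂ} {α β : Fin m → ℂ → ℂ}
    {z₀ : ℂ} {k : Fin m} (hDopen : IsOpen D) (hDconn : IsPreconnected D)
    (hα : ∀ k, AnalyticOnNhd ℂ (α k) D) (hβ : ∀ k, AnalyticOnNhd ℂ (β k) D)
    (hα0 : ∃ z ∈ D, α k z ≠ 0) (hz₀ : z₀ ∈ D)
    (h0 : β k z₀ ≠ 0) (hk : ∀ l, l ≠ k → ‖β l z₀‖ < ‖β k z₀‖) (hαk : α k z₀ = 0) :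
    z₀ ∈ liminfSets D (fun n => zeroSet D (fSeq α β n)) := by
  refine ⟨hz₀, fun U hU => ?_⟩
  obtain ⟨V, hV, hV0, hu⟩ := exists_nhds_tendstoUniformlyOn
    (fun k => (hα k z₀ hz₀).continuousAt) (fun k => (hβ k z₀ hz₀).continuousAt) h0 hk
  have hpunct := eventually_nhdsNE_ne_zero hDconn (hα k) hα0 hz₀
  rw [eventually_nhdsWithin_iff] at hpunct
  obtain ⟨ρ, hρ, hball⟩ := Metric.nhds_basis_closedBall.mem_iff.mp
    (inter_mem (inter_mem hU (hDopen.mem_nhds hz₀)) (inter_mem hV hpunct))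
  have hD : Metric.closedBall z₀ ρ ⊆ D := fun z hz => (hball hz).1.2
  have hB : Metric.closedBall z₀ ρ ⊆ V := fun z hz => (hball hz).2.1
  have hzeros := Complex.eventually_exists_zero_of_tendstoUniformlyOn hρ
    (fun n => ((differentiableOn_fSeq hα hβ n).mono hD).fun_div
      (((hβ k).differentiableOn.mono hD).fun_pow n) fun z hz => pow_ne_zero n (hV0 z (hB hz)))
    ((hα k).continuousOn.mono (Metric.sphere_subset_closedBall.trans hD))
    (fun z hz => (hball (Metric.sphere_subset_closedBall hz)).2.2
      (Metric.ne_of_mem_sphere hz hρ.ne')) hαk (hu.mono hB)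
  filter_upwards [hzeros] with n hn
  obtain ⟨z, hz, hz0⟩ := hn
  refine ⟨z, (hball hz).1.1, hD hz, ?_⟩
  exact (div_eq_zero_iff.mp hz0).resolve_right (pow_ne_zero n (hV0 z (hB hz)))

/-- A point with two dominant indices is a limit of zeros. -/
theorem mem_liminfSets_of_two_dominant {m : ℕ} {D : Set ℂ} {α β : Fin m → ℂ → ℂ}
    (hdom : NoDegenerateDominance D β) (hDopen : IsOpen D)
    (hDconn : IsPreconnected D) (hα : ∀ k, AnalyticOnNhd ℂ (α k) D)
    (hβ : ∀ k, AnalyticOnNhd ℂ (β k) D)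
    (hα0 : ∀ k, ∃ z ∈ D, α k z ≠ 0) (hβ0 : ∀ k, ∃ z ∈ D, β k z ≠ 0)
    {z₀ : ℂ} (hz₀ : z₀ ∈ D) {i j : Fin m} (hij : i ≠ j)
    (hi : IsDominant β i z₀) (hj : IsDominant β j z₀) :
    z₀ ∈ liminfSets D (fun n => zeroSet D (fSeq α β n)) := by
  refine ⟨hz₀, fun U hU => ?_⟩
  by_cases hi0 : β i z₀ = 0
  -- All `β_l` vanish at `z₀`; `n = 0` is excluded because `0 ^ 0 = 1`.
  · filter_upwards [eventually_ge_atTop 1] with n hn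
    refine ⟨z₀, mem_of_mem_nhds hU, hz₀, Finset.sum_eq_zero fun l _ => ?_⟩
    have h1 := hi l
    rw [hi0, norm_zero, norm_le_zero_iff] at h1
    rw [h1, zero_pow (by lia), mul_zero]
  by_contra hcon
  have hm : 0 < m := i.pos
  have hcα : ∀ {z}, z ∈ D → ∀ k, ContinuousAt (α k) z := fun hz k => (hα k _ hz).continuousAt
  have hcβ : ∀ {z}, z ∈ D → ∀ k, ContinuousAt (β k) z := fun hz k => (hβ k _ hz).continuousAt
  have hne : ∀ᶠ z in 𝓝 z₀, ∀ k, IsDominant β k z₀ → β k z ≠ 0 := by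
    refine eventually_all.mpr fun k => ?_
    by_cases hk : IsDominant β k z₀
    · refine ((hcβ hz₀ k).eventually_ne fun h => hi0 ?_).mono fun z hz _ => hz
      have h1 := hk i
      rwa [h, norm_zero, norm_le_zero_iff] at h1
    · exact Eventually.of_forall fun z h => absurd h hk
  obtain ⟨ρ', hρ', hball⟩ := Metric.nhds_basis_closedBall.mem_iff.mp
    (inter_mem (inter_mem hU (hDopen.mem_nhds hz₀))
      (inter_mem (eventually_isDominant_imp (hcβ hz₀)) hne))
  -- With `p`, `q` within `ρ` of `z₀`, the ball of radius `2ρ` about `p` contains `q` and stays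
  -- within `3ρ` of `z₀`.
  obtain ⟨ρ, rfl⟩ : ∃ ρ, ρ' = 3 * ρ := ⟨ρ' / 3, by ring⟩
  have hρ : 0 < ρ := by linarith
  have hsmall : Metric.ball z₀ ρ ⊆ Metric.closedBall z₀ (3 * ρ) :=
    Metric.ball_subset_closedBall.trans (Metric.closedBall_subset_closedBall (by linarith))
  have hbD : Metric.closedBall z₀ (3 * ρ) ⊆ D := fun z hz => (hball hz).1.2
  obtain ⟨p, hp, k, hk, hkα⟩ := hdom.exists_strictly_dominant hm hDopen hDconn hα hβ hα0 hβ0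
    Metric.isOpen_ball ⟨z₀, Metric.mem_ball_self hρ⟩ (hsmall.trans hbD)
  have hkp : IsDominant β k p := fun l => by
    by_cases hl : l = k
    · rw [hl]
    · exact (hk l hl).le
  have hkz₀ : IsDominant β k z₀ := (hball (hsmall hp)).2.1 k hkp
  have hk0 : ∀ z ∈ Metric.closedBall z₀ (3 * ρ), β k z ≠ 0 := fun z hz => (hball hz).2.2 k hkz₀
  obtain ⟨w, hw, l, hl⟩ : ∃ w ∈ Metric.ball z₀ ρ, ∃ l, ‖β k w‖ < ‖β l w‖ := by
    by_contra! hno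
    have hkev : ∀ᶠ z in 𝓝 z₀, IsDominant β k z := by
      filter_upwards [Metric.ball_mem_nhds z₀ hρ] with z hz
      exact hno z hz
    have h1 := fun a ha => hdom.eq_of_eventually_isDominant (l := a) hDopen hDconn hβ hz₀ hkev ha
      (hk0 z₀ (Metric.mem_closedBall_self hρ'.le))
    exact hij ((h1 i hi).trans (h1 j hj).symm)
  have hWopen : IsOpen (Metric.ball z₀ ρ ∩ {z | ‖β k z‖ < ‖β l z‖}) := by
    rw [isOpen_iff_mem_nhds]
    rintro z ⟨hz, hzl⟩
    have hzD := hbD (hsmall hz)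
    exact inter_mem (Metric.isOpen_ball.mem_nhds hz)
      ((hcβ hzD k).norm.eventually_lt (hcβ hzD l).norm hzl)
  obtain ⟨q, ⟨hq, hql⟩, k', hk', hk'α⟩ := hdom.exists_strictly_dominant hm hDopen hDconn hα hβ
    hα0 hβ0 hWopen ⟨w, hw, hl⟩ (Set.inter_subset_left.trans (hsmall.trans hbD))
  have hkk' : k ≠ k' := by
    rintro rfl
    by_cases hlk : l = k
    · rw [hlk] at hql
      exact lt_irrefl ‖β k q‖ hql
    · exact lt_asymm hql (hk' l hlk)
  have hqkk' := hk' k hkk'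
  have hqD : q ∈ D := hbD (hsmall hq)
  have hpD : p ∈ D := hbD (hsmall hp)
  have hkq : 0 < ‖β k q‖ := norm_pos_iff.mpr (hk0 q (hsmall hq))
  have hk'q : 0 < ‖β k' q‖ := hkq.trans hqkk'
  -- Restricting to the zero-free `n` replaces passing to a subsequence.
  set L : Filter ℕ := atTop ⊓ 𝓟 {n | ¬ (U ∩ zeroSet D (fSeq α β n)).Nonempty} with hLdef
  have hLne : L.NeBot := Filter.frequently_mem_iff_neBot.mp (not_eventually.mp hcon)
  have hL : L ≤ atTop := inf_le_left
  have hLS : ∀ᶠ n in L, ¬ (U ∩ zeroSet D (fSeq α β n)).Nonempty :=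
    mem_inf_of_right (mem_principal_self _)
  have hsub : ∀ z ∈ Metric.ball (0 : ℂ) (2 * ρ), p + z ∈ Metric.closedBall z₀ (3 * ρ) := by
    intro z hz
    rw [mem_ball_zero_iff] at hz
    rw [Metric.mem_ball, dist_eq_norm] at hp
    rw [Metric.mem_closedBall, dist_eq_norm, add_sub_right_comm]
    linarith [norm_add_le (p - z₀) z]
  -- the functions `f_n / β_k ^ n`, centred at `p`
  let g : ℕ → ℂ → ℂ := fun n z => fSeq α β n (p + z) / β k (p + z) ^ n
  obtain ⟨V, hV, -, hu⟩ := exists_nhds_tendstoUniformlyOn (hcα hpD) (hcβ hpD)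
    (hk0 p (hsmall hp)) hk
  obtain ⟨r, hr, hrV⟩ := Metric.nhds_basis_ball.mem_iff.mp (inter_mem hV
    ((hcα hpD k).norm.eventually_lt (continuousAt_const (y := ‖α k p‖ + 1)) (by simp)))
  have hd : ∀ n, DifferentiableOn ℂ (g n) (Metric.ball 0 (2 * ρ)) := by
    intro n
    have h1 : DifferentiableOn ℂ (fun z => fSeq α β n z / β k z ^ n)
        (Metric.closedBall z₀ (3 * ρ)) :=
      ((differentiableOn_fSeq hα hβ n).mono hbD).fun_div
        (((hβ k).differentiableOn.mono hbD).fun_pow n) fun z hz => pow_ne_zero n (hk0 z hz)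
    exact h1.comp (differentiableOn_id.const_add p) hsub
  have hg0 : ∀ᶠ n in L, ∀ z ∈ Metric.ball (0 : ℂ) (2 * ρ), g n z ≠ 0 := by
    filter_upwards [hLS] with n hn z hz h0
    have h1 := hball (hsub z hz)
    exact hn ⟨p + z, h1.1.1, h1.1.2,
      (div_eq_zero_iff.mp h0).resolve_right (pow_ne_zero n (hk0 _ (hsub z hz)))⟩
  obtain ⟨K, hK1, hgK⟩ : ∃ K : ℝ, 1 < K ∧ ∀ᶠ n in L, ∀ z ∈ Metric.ball (0 : ℂ) (2 * ρ),
      ‖g n z‖ ≤ K ^ n := by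
    have hcpt := isCompact_closedBall z₀ (3 * ρ)
    have ha : ∀ l, ∃ a, ∀ z ∈ Metric.closedBall z₀ (3 * ρ), ‖α l z‖ ≤ a := fun l =>
      hcpt.exists_bound_of_continuousOn ((hα l).continuousOn.mono hbD)
    have hb : ∀ l, ∃ b, ∀ z ∈ Metric.closedBall z₀ (3 * ρ), ‖β l z / β k z‖ ≤ b := fun l =>
      hcpt.exists_bound_of_continuousOn
        (((hβ l).continuousOn.mono hbD).div ((hβ k).continuousOn.mono hbD) hk0)
    choose a ha using ha
    choose b hb using hb
    set A := ∑ l, |a l| with hA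
    set B := ∑ l, |b l| with hB
    have hA0 : 0 ≤ A := Finset.sum_nonneg fun l _ => abs_nonneg _
    have hB0 : 0 ≤ B := Finset.sum_nonneg fun l _ => abs_nonneg _
    -- The shifts give `K > 1` and let `A` be absorbed into an `n`-th power.
    refine ⟨(A + 1) * (B + 2), by nlinarith, ?_⟩
    filter_upwards [hL (eventually_ge_atTop 1)] with n hn z hz
    have hz' := hsub z hz
    calc ‖g n z‖ = ‖∑ l, α l (p + z) * (β l (p + z) / β k (p + z)) ^ n‖ := by
          simp only [g, fSeq, Finset.sum_div, div_pow, mul_div_assoc]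
      _ ≤ ∑ l, ‖α l (p + z) * (β l (p + z) / β k (p + z)) ^ n‖ := norm_sum_le _ _
      _ ≤ ∑ l, |a l| * (B + 2) ^ n := by
          refine Finset.sum_le_sum fun l _ => ?_
          rw [norm_mul, norm_pow]
          gcongr
          · exact (ha l _ hz').trans (le_abs_self _)
          · have h1 : |b l| ≤ B :=
              Finset.single_le_sum (fun l _ => abs_nonneg (b l)) (Finset.mem_univ l)
            linarith [(hb l _ hz').trans (le_abs_self _)]
      _ = A * (B + 2) ^ n := by rw [← Finset.sum_mul]
      _ ≤ (A + 1) ^ n * (B + 2) ^ n := by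
          gcongr
          calc A ≤ A + 1 := by linarith
            _ ≤ (A + 1) ^ n := le_self_pow₀ (by linarith) (by lia)
      _ = ((A + 1) * (B + 2)) ^ n := (mul_pow _ _ _).symm
  have hgC : ∀ᶠ n in L, ∀ z ∈ Metric.ball (0 : ℂ) r, ‖g n z‖ ≤ ‖α k p‖ + 2 := by
    filter_upwards [hL (Metric.tendstoUniformlyOn_iff.mp hu 1 one_pos)] with n hn z hz
    have hz' : p + z ∈ Metric.ball p r := by simpa using hz
    have h1 := hn _ (hrV hz').1
    have h2 : ‖α k (p + z)‖ < ‖α k p‖ + 1 := (hrV hz').2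
    rw [dist_comm, dist_eq_norm] at h1
    have h3 := norm_sub_norm_le (g n z) (α k (p + z))
    simp only [g] at h3 ⊢
    linarith
  have hgc : ∀ᶠ n in L, ‖α k p‖ / 2 ≤ ‖g n 0‖ := by
    have h1 : Tendsto (fun n => ‖g n 0‖) atTop (𝓝 ‖α k p‖) := by
      simpa [g] using (hu.tendsto_at (mem_of_mem_nhds hV)).norm
    exact hL ((h1.eventually (lt_mem_nhds (half_lt_self (norm_pos_iff.mpr hkα)))).mono
      fun n hn => hn.le)
  obtain ⟨s, hs1, hs⟩ := exists_between ((one_lt_div hkq).mpr hqkk')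
  have hs0 : 0 < s := one_pos.trans hs1
  have hqp : q - p ∈ Metric.ball (0 : ℂ) (2 * ρ) := by
    rw [mem_ball_zero_iff, ← dist_eq_norm]
    linarith [dist_triangle_right q p z₀, Metric.mem_ball.mp hq, Metric.mem_ball.mp hp]
  have hgrowth := Complex.eventually_norm_le_pow_of_ne_zero hL hK1 hr
    (half_pos (norm_pos_iff.mpr hkα)) (Eventually.of_forall hd) hg0 hgK hgC hgc hqp hs1
  -- at `q` the growth is governed by `β_k'`
  obtain ⟨V', hV', -, hu'⟩ := exists_nhds_tendstoUniformlyOn (hcα hqD) (hcβ hqD)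
    (norm_pos_iff.mp hk'q) hk'
  have hlim := (hu'.tendsto_at (mem_of_mem_nhds hV')).norm.mono_left hL
  have hzero : Tendsto (fun n : ℕ => (s * ‖β k q‖ / ‖β k' q‖) ^ n) L (𝓝 0) := by
    refine (tendsto_pow_atTop_nhds_zero_of_lt_one (by positivity) ?_).mono_left hL
    rw [div_lt_one hk'q]
    exact (lt_div_iff₀ hkq).mp hs
  refine hk'α (norm_le_zero_iff.mp (le_of_tendsto_of_tendsto hlim hzero ?_))
  filter_upwards [hgrowth] with n hn
  simp only [g, add_sub_cancel] at hn
  rw [norm_div, norm_pow, div_le_iff₀ (by positivity), ← mul_pow] at hn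
  rw [norm_div, norm_pow, div_pow]
  gcongr

end BKW

/-! ### The main theorem -/

theorem theorem1p5 (D : Set ℂ) (hDopen : IsOpen D) (hDconn : IsConnected D)
    (m : ℕ) (hm : 2 ≤ m) (α β : Fin m → ℂ → ℂ)
    (hα : ∀ k, AnalyticOnNhd ℂ (α k) D) (hβ : ∀ k, AnalyticOnNhd ℂ (β k) D)
    (hα0 : ∀ k, ∃ z ∈ D, α k z ≠ 0) (hβ0 : ∀ k, ∃ z ∈ D, β k z ≠ 0)
    (hdom : BKW.NoDegenerateDominance D β) :
    BKW.liminfSets D (fun n => BKW.zeroSet D (BKW.fSeq α β n)) =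
        BKW.limsupSets D (fun n => BKW.zeroSet D (BKW.fSeq α β n)) ∧
      ∀ z ∈ D, z ∈ BKW.liminfSets D (fun n => BKW.zeroSet D (BKW.fSeq α β n)) ↔
        (∃ k, BKW.IsDominant β k z ∧ (∀ l, BKW.IsDominant β l z → l = k) ∧ α k z = 0) ∨
        (∃ k l, k ≠ l ∧ BKW.IsDominant β k z ∧ BKW.IsDominant β l z) := by
  have hsub : BKW.liminfSets D (fun n => BKW.zeroSet D (BKW.fSeq α β n)) ⊆
      BKW.limsupSets D (fun n => BKW.zeroSet D (BKW.fSeq α β n)) :=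
    fun z hz => ⟨hz.1, fun U hU => (hz.2 U hU).frequently⟩
  have hstrict : ∀ z k, BKW.IsDominant β k z → (∀ l, BKW.IsDominant β l z → l = k) →
      β k z ≠ 0 ∧ ∀ l, l ≠ k → ‖β l z‖ < ‖β k z‖ := by
    intro z k hk huniq
    have hlt : ∀ l, l ≠ k → ‖β l z‖ < ‖β k z‖ := fun l hl =>
      lt_of_not_ge fun hle => hl (huniq l fun j => (hk j).trans hle)
    -- A second index, strictly smaller in modulus, forces `β k z ≠ 0`; this is where `m ≥ 2`
    -- enters.
    have : Nontrivial (Fin m) := Fin.nontrivial_iff_two_le.mpr hm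
    obtain ⟨l, hl⟩ := exists_ne k
    exact ⟨norm_pos_iff.mp ((norm_nonneg _).trans_lt (hlt l hl)), hlt⟩
  have hof : ∀ z ∈ D, ((∃ k, BKW.IsDominant β k z ∧ (∀ l, BKW.IsDominant β l z → l = k) ∧
      α k z = 0) ∨ (∃ k l, k ≠ l ∧ BKW.IsDominant β k z ∧ BKW.IsDominant β l z)) →
      z ∈ BKW.liminfSets D (fun n => BKW.zeroSet D (BKW.fSeq α β n)) := by
    rintro z hz (⟨k, hk, huniq, hαk⟩ | ⟨k, l, hkl, hk, hl⟩)
    · obtain ⟨h0, hlt⟩ := hstrict z k hk huniq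
      exact BKW.mem_liminfSets_of_strictly_dominant hDopen hDconn.isPreconnected hα hβ (hα0 k) hz
        h0 hlt hαk
    · exact BKW.mem_liminfSets_of_two_dominant hdom hDopen hDconn.isPreconnected hα hβ hα0 hβ0 hz
        hkl hk hl
  have hto : ∀ z ∈ BKW.limsupSets D (fun n => BKW.zeroSet D (BKW.fSeq α β n)),
      (∃ k, BKW.IsDominant β k z ∧ (∀ l, BKW.IsDominant β l z → l = k) ∧ α k z = 0) ∨
      (∃ k l, k ≠ l ∧ BKW.IsDominant β k z ∧ BKW.IsDominant β l z) := by
    intro z hz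
    by_contra! hcon
    obtain ⟨k, hk⟩ := BKW.exists_isDominant (by lia) β z
    have huniq : ∀ l, BKW.IsDominant β l z → l = k := fun l hl => by
      by_contra hlk
      exact hcon.2 l k hlk hl hk
    obtain ⟨h0, hlt⟩ := hstrict z k hk huniq
    exact BKW.notMem_limsupSets (fun k => (hα k z hz.1).continuousAt)
      (fun k => (hβ k z hz.1).continuousAt) h0 hlt (hcon.1 k hk huniq) hz
  exact ⟨hsub.antisymm fun z hz => hof z hz.1 (hto z hz),
    fun z hz => ⟨fun h => hto z (hsub h), hof z hz⟩⟩
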